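/- Let $p$ be a prime. All fields below are finite extensions of $\mathbb{Q}_p$. For a finite Galois extension $M/E$ with group $G$ and an integer $i\ge -1$ let $$G_i=\{\sigma\in G : \sigma(x)\equiv x \bmod \mathfrak{p}_M^{\,i+1}\ \text{for all } x\in\mathcal{O}_M\},$$ where $\mathcal{O}_M$ is the ring of integers of $M$ and $\mathfrak{p}_M$ its maximal ideal (and $G_i=G$ for $i<-1$). A jump of $M/E$ is an integer $t$ with $G_t\neq G_{t+1}$. Let $K_1$ and $K_2$ be two such fields contained in a common field, and put $K=K_1\cap K_2$. Suppose that $K_1/K$ and $K_2/K$ are Galois, that the compositum $K_1K_2$ is totally ramified over $K$, and that each of the extensions $K_1/K$, $K_2/K$, $K_1K_2/K_2$, $K_1K_2/K_1$ has exactly one jump; denote these jumps by $t_1$, $t_2$, $t'_1$, $t'_2$ respectively. Let $d_i=[K_i:K]$ for $i=1,2$. Then: (i) $d_2(d_1-1)t_1+(d_2-1)t'_2=d_1(d_2-1)t_2+(d_1-1)t'_1$. (ii) If moreover $d_1=d_2=p$ and $t'_1<t'_2$, then $t'_1=t_1$ and $t'_2=p\,t_2+(1-p)\,t_1$. -/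

import Mathlib

namespace LocalRamification

section Integers

variable (p : ℕ) [Fact p.Prime] (L : Type*) [Field L] [Algebra ℚ_[p] L]

/-- The ring of integers `𝓞_L` of an algebraic extension `L` of `ℚ_p`: the integral closure
of `ℤ_p` (here: as a subring of `ℚ_p`) in `L`. -/
noncomputable abbrev integers : Subalgebra (PadicInt.subring p) L :=
  integralClosure (PadicInt.subring p) L

variable {p L} in
/-- Integrality over `ℤ_p` is detected by the norm of `L` that extends the `p`-adic one. -/
theorem mem_integers_iff [Algebra.IsAlgebraic ℚ_[p] L] (x : L) :
    x ∈ integers p L ↔ spectralNorm ℚ_[p] L x ≤ 1 := by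
  have hx : IsIntegral ℚ_[p] x := Algebra.IsIntegral.isIntegral x
  unfold spectralNorm
  rw [spectralValue_le_one_iff (minpoly.monic hx)]
  constructor
  · intro h n
    have : IsFractionRing (PadicInt.subring p) ℚ_[p] :=
      inferInstanceAs (IsFractionRing ℤ_[p] ℚ_[p])
    have : IsDomain (PadicInt.subring p) := inferInstanceAs (IsDomain ℤ_[p])
    have : IsIntegrallyClosed (PadicInt.subring p) :=
      inferInstanceAs (IsIntegrallyClosed ℤ_[p])
    rw [minpoly.isIntegrallyClosed_eq_field_fractions' ℚ_[p]
      (show IsIntegral (PadicInt.subring p) x from h), Polynomial.coeff_map]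
    exact ((minpoly (PadicInt.subring p) x).coeff n).2
  · intro h
    have hl : minpoly ℚ_[p] x ∈ Polynomial.lifts (algebraMap (PadicInt.subring p) ℚ_[p]) := by
      rw [Polynomial.lifts_iff_coeff_lifts]
      intro n
      exact ⟨⟨_, h n⟩, rfl⟩
    obtain ⟨q, hq, -, hm⟩ := Polynomial.lifts_and_natDegree_eq_and_monic hl (minpoly.monic hx)
    refine ⟨q, hm, ?_⟩
    have h0 := minpoly.aeval ℚ_[p] x
    rw [← hq, Polynomial.aeval_map_algebraMap] at h0
    exact h0

instance isLocalRing_integers [Algebra.IsAlgebraic ℚ_[p] L] : IsLocalRing (integers p L) := by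
  have key : ∀ x : integers p L, IsUnit x ↔ spectralNorm ℚ_[p] L (x : L) = 1 := by
    intro x
    have hmul : ∀ a b : L, spectralNorm ℚ_[p] L (a * b) =
        spectralNorm ℚ_[p] L a * spectralNorm ℚ_[p] L b := fun a b => spectralAlgNorm_mul a b
    constructor
    · rintro ⟨u, rfl⟩
      have h1 := (mem_integers_iff ((u : integers p L) : L)).1 (u : integers p L).2
      have h2 := (mem_integers_iff (((u⁻¹ : (integers p L)ˣ) : integers p L) : L)).1
        ((u⁻¹ : (integers p L)ˣ) : integers p L).2
      have h3 := hmul ((u : integers p L) : L) (((u⁻¹ : (integers p L)ˣ) : integers p L) : L)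
      rw [← Subalgebra.coe_mul, Units.mul_inv, Subalgebra.coe_one, spectralNorm_one] at h3
      have h4 := spectralNorm_nonneg (K := ℚ_[p]) ((u : integers p L) : L)
      nlinarith
    · intro h
      have hx0 : (x : L) ≠ 0 := by
        intro h0
        rw [h0, spectralNorm_zero] at h
        exact zero_ne_one h
      have hi := hmul (x : L) (x : L)⁻¹
      rw [mul_inv_cancel₀ hx0, spectralNorm_one, h, one_mul] at hi
      refine IsUnit.of_mul_eq_one ⟨(x : L)⁻¹, (mem_integers_iff _).2 hi.ge⟩ ?_
      exact Subtype.ext (mul_inv_cancel₀ hx0)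
  refine IsLocalRing.of_nonunits_add fun a b ha hb => ?_
  simp only [mem_nonunits_iff, key] at ha hb ⊢
  have h1 := lt_of_le_of_ne ((mem_integers_iff (a : L)).1 a.2) ha
  have h2 := lt_of_le_of_ne ((mem_integers_iff (b : L)).1 b.2) hb
  have h3 : spectralNorm ℚ_[p] L ((a : L) + (b : L)) ≤
      max (spectralNorm ℚ_[p] L (a : L)) (spectralNorm ℚ_[p] L (b : L)) :=
    isNonarchimedean_spectralNorm _ _
  rw [Subalgebra.coe_add]
  exact (h3.trans_lt (max_lt h1 h2)).ne

/-- The prime ideal `𝔭_L` of `L`: the maximal ideal of `𝓞_L`. -/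
noncomputable abbrev primeIdeal [Algebra.IsAlgebraic ℚ_[p] L] : Ideal (integers p L) :=
  IsLocalRing.maximalIdeal (integers p L)

end Integers

section Extension

variable (p : ℕ) [Fact p.Prime] (K L : Type*) [Field K] [Field L] [Algebra ℚ_[p] K]
  [Algebra ℚ_[p] L] [Algebra K L] [IsScalarTower ℚ_[p] K L]

/-- The inclusion `𝓞_K → 𝓞_L`. -/
noncomputable def integersMap : integers p K →+* integers p L where
  toFun x := ⟨algebraMap K L x,
    x.2.map ((IsScalarTower.toAlgHom ℚ_[p] K L).restrictScalars (PadicInt.subring p))⟩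
  map_one' := Subtype.ext (map_one _)
  map_mul' _ _ := Subtype.ext (map_mul _ _ _)
  map_zero' := Subtype.ext (map_zero _)
  map_add' _ _ := Subtype.ext (map_add _ _ _)

/-- The extension `L/K` is totally ramified: its ramification index is its degree, i.e.
`𝔭_K 𝓞_L = 𝔭_L ^ [L : K]`. -/
def IsTotallyRamified [Algebra.IsAlgebraic ℚ_[p] K] [Algebra.IsAlgebraic ℚ_[p] L] : Prop :=
  (primeIdeal p K).map (integersMap p K L) = primeIdeal p L ^ Module.finrank K L

instance isScalarTower_intermediateField (M : IntermediateField K L) :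
    IsScalarTower ℚ_[p] M L :=
  ⟨fun a x y => smul_mul_assoc a (x : L) y⟩

instance smulCommClass_padicInt : SMulCommClass (L ≃ₐ[K] L) (PadicInt.subring p) L where
  smul_comm σ a x := by
    have h : ∀ y : L, a • y = algebraMap K L (algebraMap ℚ_[p] K (a : ℚ_[p])) * y := fun y => by
      rw [← IsScalarTower.algebraMap_apply ℚ_[p] K L]
      exact Algebra.smul_def (a : ℚ_[p]) y
    rw [h, h, AlgEquiv.smul_def, AlgEquiv.smul_def, map_mul, AlgEquiv.commutes]

/-- The `i`-th ramification group (lower numbering) of `L/K`: the `σ` in `Gal(L/K)` such that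
`σ x ≡ x mod 𝔭_L ^ (i + 1)` for all `x` in `𝓞_L`. For `i ≤ -1` this is all of `Gal(L/K)`. -/
noncomputable def ramificationGroup [Algebra.IsAlgebraic ℚ_[p] L] (i : ℤ) :
    Subgroup (L ≃ₐ[K] L) :=
  (primeIdeal p L ^ (i + 1).toNat).inertia (L ≃ₐ[K] L)

/-- `t` is a jump of `L/K`. -/
def IsJump [Algebra.IsAlgebraic ℚ_[p] L] (t : ℤ) : Prop :=
  ramificationGroup p K L t ≠ ramificationGroup p K L (t + 1)

/-- `t` is a jump of `L/K`, and the only one. -/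
def IsUniqueJump [Algebra.IsAlgebraic ℚ_[p] L] (t : ℤ) : Prop :=
  IsJump p K L t ∧ ∀ s : ℤ, IsJump p K L s → s = t

end Extension

end LocalRamification

/-! Write L = K₁K₂. Since K₁ ∩ K₂ = K, Gal(L/K) is the product of the commuting subgroups Gal(L/K₂)
and Gal(L/K₁), of orders d₁ and d₂. For a uniformizer x of L, consider the matrix D(σ, τ) = v_L(στx
- x), with σ in Gal(L/K₂) and τ in Gal(L/K₁).

Total ramification gives 𝓞_L = 𝓞_K[x], so v_L(σx - x) determines the ramification groups, and a
unique jump t means that this value is t + 1 for every σ ≠ 1. Hence D(1, τ) = t₂' + 1 and D(σ, 1) =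
t₁' + 1 off the identity. The quotient formula for lower numbering (`sum_depth_mul`) turns the row
of σ ≠ 1 into a value on K₁, with sum d₂(t₁ + 1); likewise the column of τ ≠ 1 has sum d₁(t₂ + 1).
Summing D by rows and by columns gives (i).

For (ii), if t₁' < t₂' then the ultrametric inequality makes each row σ ≠ 1 constant, equal to t₁' +
1 (`depth_mul_of_lt`). Its known sum yields t₁' = t₁, and (i) then gives t₂'. -/

namespace LocalRamification

open IsDiscreteValuationRing

/-! ### Valuations of sums in a discrete valuation ring -/

section DiscreteValuation

variable {C : Type*} [CommRing C] [IsDomain C] [IsDiscreteValuationRing C]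

theorem addVal_sub (a b : C) : min (addVal C a) (addVal C b) ≤ addVal C (a - b) := by
  have h := addVal_add (a := a) (b := -b)
  rwa [sub_eq_add_neg, ← (addVal_eq_iff_associated (-b) b).2 (Associated.refl b).neg_left]

theorem addVal_add_eq_of_lt {a b : C} (h : addVal C a < addVal C b) :
    addVal C (a + b) = addVal C a := by
  refine le_antisymm ?_ ((le_min le_rfl h.le).trans addVal_add)
  by_contra! hlt
  have := addVal_sub (a + b) b
  rw [add_sub_cancel_right] at this
  exact absurd this (not_le.2 (lt_min hlt h))

theorem le_addVal_sum {ι : Type*} (s : Finset ι) (f : ι → C) (n : ℕ∞)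
    (h : ∀ i ∈ s, n ≤ addVal C (f i)) : n ≤ addVal C (∑ i ∈ s, f i) := by
  classical
  induction s using Finset.induction_on with
  | empty => simp
  | insert a s ha ih =>
    rw [Finset.sum_insert ha]
    exact (le_min (h a (by simp)) (ih fun i hi => h i (by simp [hi]))).trans addVal_add

theorem addVal_prod {ι : Type*} (s : Finset ι) (f : ι → C) :
    addVal C (∏ i ∈ s, f i) = ∑ i ∈ s, addVal C (f i) := by
  classical
  induction s using Finset.induction_on with
  | empty => simp
  | insert a s ha ih => rw [Finset.prod_insert ha, Finset.sum_insert ha, addVal_mul, ih]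

/-- A sum is not more divisible than any of its terms if the nonzero terms have distinct
valuations. -/
theorem addVal_sum_le {ι : Type*} (s : Finset ι) (f : ι → C)
    (hf : ∀ i ∈ s, ∀ j ∈ s, f i ≠ 0 → addVal C (f i) = addVal C (f j) → i = j)
    {i : ι} (hi : i ∈ s) : addVal C (∑ j ∈ s, f j) ≤ addVal C (f i) := by
  classical
  obtain ⟨m, hm, hmin⟩ := s.exists_min_image (fun j => addVal C (f j)) ⟨i, hi⟩
  refine le_trans ?_ (hmin i hi)
  by_cases h0 : f m = 0
  · simp [h0]
  -- The strict bound is stated with `+ 1` so that it passes to the sum of the remaining terms, even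
  -- an empty one.
  have hlt : ∀ j ∈ s.erase m, addVal C (f m) + 1 ≤ addVal C (f j) := by
    intro j hj
    rw [Finset.mem_erase] at hj
    refine Order.add_one_le_of_lt (lt_of_le_of_ne (hmin j hj.2) fun h => hj.1 ?_)
    exact (hf m hm j hj.2 h0 h).symm
  rw [← Finset.add_sum_erase s f hm]
  refine (addVal_add_eq_of_lt (lt_of_lt_of_le ?_ (le_addVal_sum _ _ _ hlt))).le
  exact ENat.lt_add_one_iff (fun h => h0 (addVal_eq_top_iff.1 h)) |>.2 le_rfl

theorem mem_maximalIdeal_pow_iff (x : C) (n : ℕ) :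
    x ∈ IsLocalRing.maximalIdeal C ^ n ↔ (n : ℕ∞) ≤ addVal C x := by
  obtain ⟨ϖ, hϖ⟩ := exists_irreducible C
  rw [hϖ.maximalIdeal_eq, Ideal.span_singleton_pow, Ideal.mem_span_singleton,
    ← addVal_le_iff_dvd, hϖ.addVal_pow]

theorem maximalIdeal_pow_injective {m n : ℕ}
    (h : IsLocalRing.maximalIdeal C ^ m = IsLocalRing.maximalIdeal C ^ n) : m = n := by
  obtain ⟨ϖ, hϖ⟩ := exists_irreducible C
  have h1 := (mem_maximalIdeal_pow_iff (ϖ ^ n) m).1 (by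
    rw [h, mem_maximalIdeal_pow_iff, hϖ.addVal_pow])
  have h2 := (mem_maximalIdeal_pow_iff (ϖ ^ m) n).1 (by
    rw [← h, mem_maximalIdeal_pow_iff, hϖ.addVal_pow])
  rw [hϖ.addVal_pow, Nat.cast_le] at h1 h2
  exact le_antisymm h1 h2

variable {A : Type*} [CommRing A] [IsDomain A] [IsDiscreteValuationRing A]

theorem addVal_map {φ : A →+* C} {e : ℕ}
    (h : (IsLocalRing.maximalIdeal A).map φ = IsLocalRing.maximalIdeal C ^ e)
    (he : e ≠ 0) (x : A) :
    addVal C (φ x) = e * addVal A x := by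
  obtain ⟨ϖ, hϖ⟩ := exists_irreducible A
  obtain ⟨ψ, hψ⟩ := exists_irreducible C
  by_cases hx : x = 0
  · simp [hx, ENat.mul_top, he]
  obtain ⟨n, u, rfl⟩ := eq_unit_mul_pow_irreducible hx hϖ
  rw [hϖ.maximalIdeal_eq, hψ.maximalIdeal_eq, Ideal.map_span, Set.image_singleton,
    Ideal.span_singleton_pow, Ideal.span_singleton_eq_span_singleton,
    ← addVal_eq_iff_associated, hψ.addVal_pow] at h
  have hu : addVal C (φ u) = 0 := addVal_eq_zero_of_unit (u.map (φ : A →* C))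
  rw [map_mul, map_pow, addVal_mul, addVal_pow, h, hu, addVal_def' u hϖ, nsmul_eq_mul, zero_add,
    mul_comm]

/-- Below the ramification index `e`, the powers of a uniformizer have distinct valuations
modulo `e`. -/
theorem addVal_sum_map_mul_pow_le {φ : A →+* C} {e : ℕ}
    (h : (IsLocalRing.maximalIdeal A).map φ = IsLocalRing.maximalIdeal C ^ e)
    {ϖ : C} (hϖ : Irreducible ϖ) (a : Fin e → A) (i : Fin e) :
    addVal C (∑ j, φ (a j) * ϖ ^ (j : ℕ)) ≤ e * addVal A (a i) + (i : ℕ) := by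
  have he : e ≠ 0 := fun h0 => by subst h0; exact i.elim0
  have key : ∀ j : Fin e, addVal C (φ (a j) * ϖ ^ (j : ℕ)) = e * addVal A (a j) + (j : ℕ) := by
    intro j
    rw [addVal_mul, addVal_map h he, hϖ.addVal_pow]
  rw [← key]
  refine addVal_sum_le _ (fun j => φ (a j) * ϖ ^ (j : ℕ)) (fun j _ k _ hj hjk => ?_)
    (Finset.mem_univ i)
  simp only [key] at hjk
  have hj0 : a j ≠ 0 := fun h0 => hj (by simp [h0])
  obtain ⟨m, hm⟩ := ENat.ne_top_iff_exists.1 (fun h => hj0 (addVal_eq_top_iff.1 h))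
  rw [← hm] at hjk
  have hk : addVal A (a k) ≠ ⊤ := by
    intro hk
    rw [hk, ENat.mul_top (by exact_mod_cast he), top_add] at hjk
    exact absurd hjk (by exact_mod_cast ENat.natCast_ne_top (e * m + j))
  obtain ⟨l, hl⟩ := ENat.ne_top_iff_exists.1 hk
  rw [← hl] at hjk
  have hjk' : e * m + (j : ℕ) = e * l + (k : ℕ) := by exact_mod_cast hjk
  have := congrArg (· % e) hjk'
  simp only [Nat.mul_add_mod, Nat.mod_eq_of_lt j.2, Nat.mod_eq_of_lt k.2] at this
  exact Fin.ext this

end DiscreteValuation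

/-! ### The ring of integers is a discrete valuation ring -/

section Integers

variable (p : ℕ) [Fact p.Prime] (L : Type*) [Field L] [Algebra ℚ_[p] L]

instance isFractionRing_padicInt : IsFractionRing (PadicInt.subring p) ℚ_[p] :=
  inferInstanceAs (IsFractionRing ℤ_[p] ℚ_[p])

instance isDiscreteValuationRing_padicInt : IsDiscreteValuationRing (PadicInt.subring p) :=
  inferInstanceAs (IsDiscreteValuationRing ℤ_[p])

instance isFractionRing_integers [FiniteDimensional ℚ_[p] L] :
    IsFractionRing (integers p L) L :=
  integralClosure.isFractionRing_of_finite_extension ℚ_[p] L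

instance isDiscreteValuationRing_integers [FiniteDimensional ℚ_[p] L] :
    IsDiscreteValuationRing (integers p L) := by
  have : IsDedekindDomain (integers p L) :=
    integralClosure.isDedekindDomain (PadicInt.subring p) ℚ_[p] L
  have hf : ¬ IsField (integers p L) := by
    have hinj : Function.Injective (algebraMap (PadicInt.subring p) (integers p L)) := by
      intro a b hab
      have h := congrArg (fun x : integers p L => (x : L)) hab
      exact Subtype.ext ((algebraMap ℚ_[p] L).injective h)
    intro h
    exact not_isField (PadicInt.subring p) (isField_of_isIntegral_of_isField hinj h)
  exact ((IsDiscreteValuationRing.TFAE (integers p L) hf).out 0 2).2 this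

end Integers

/-! ### Totally ramified extensions: towers and monogenicity -/

section Extension

variable (p : ℕ) [Fact p.Prime] (K M L : Type*) [Field K] [Field M] [Field L] [Algebra ℚ_[p] K]
  [Algebra ℚ_[p] M] [Algebra ℚ_[p] L] [Algebra K L] [IsScalarTower ℚ_[p] K L]
  [Algebra K M] [IsScalarTower ℚ_[p] K M] [Algebra M L] [IsScalarTower ℚ_[p] M L]

@[simp]
theorem coe_integersMap (x : integers p K) :
    (integersMap p K L x : L) = algebraMap K L x := rfl

theorem integersMap_injective : Function.Injective (integersMap p K L) := fun _ _ h =>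
  Subtype.ext ((algebraMap K L).injective (congrArg Subtype.val h))

theorem integersMap_comp [IsScalarTower K M L] :
    (integersMap p M L).comp (integersMap p K M) = integersMap p K L :=
  RingHom.ext fun x => Subtype.ext (IsScalarTower.algebraMap_apply K M L x).symm

/-- `𝓞_L = 𝓞_K[x]`. -/
def IsIntegralGenerator (x : integers p L) : Prop :=
  ∀ y : integers p L, ∃ g : Polynomial (integers p K), y = g.eval₂ (integersMap p K L) x

variable {p K M L}

theorem IsIntegralGenerator.of_tower [IsScalarTower K M L] {x : integers p L}
    (h : IsIntegralGenerator p K L x) : IsIntegralGenerator p M L x := by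
  intro y
  obtain ⟨g, rfl⟩ := h y
  exact ⟨g.map (integersMap p K M), by rw [Polynomial.eval₂_map, integersMap_comp]⟩

variable [FiniteDimensional ℚ_[p] K] [FiniteDimensional ℚ_[p] M] [FiniteDimensional ℚ_[p] L]

theorem exists_map_primeIdeal_eq_pow :
    ∃ e : ℕ, (primeIdeal p K).map (integersMap p K L) = primeIdeal p L ^ e := by
  obtain ⟨ψ, hψ⟩ := exists_irreducible (integers p L)
  obtain ⟨e, he⟩ := ideal_eq_span_pow_irreducible
    (s := (primeIdeal p K).map (integersMap p K L)) (by
      rw [Ne, Ideal.map_eq_bot_iff_of_injective (integersMap_injective p K L)]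
      exact not_a_field _) hψ
  exact ⟨e, by rw [he, primeIdeal, hψ.maximalIdeal_eq, Ideal.span_singleton_pow]⟩

/-- Once denominators are cleared, the nonzero terms of a relation have valuations distinct modulo
e, so they cannot cancel. -/
theorem linearIndependent_pow_of_map_primeIdeal_eq {e : ℕ}
    (h : (primeIdeal p K).map (integersMap p K L) = primeIdeal p L ^ e)
    {ϖ : integers p L} (hϖ : Irreducible ϖ) :
    LinearIndependent K fun j : Fin e => (ϖ : L) ^ (j : ℕ) := by
  rw [Fintype.linearIndependent_iff]
  intro g hg i
  obtain ⟨b, hb⟩ := IsLocalization.exist_integer_multiples_of_finite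
    (nonZeroDivisors (integers p K)) g
  choose a ha using hb
  have hb0 : ((b : integers p K) : K) ≠ 0 := fun h0 =>
    nonZeroDivisors.ne_zero b.2 (Subtype.ext h0)
  have ha' : ∀ j, ((a j : integers p K) : K) = (b : integers p K) * g j := ha
  have hsum : ∑ j, integersMap p K L (a j) * ϖ ^ (j : ℕ) = 0 := by
    apply Subtype.ext
    have := congrArg (fun x => algebraMap K L (b : integers p K) * x) hg
    simp only [mul_zero, Finset.mul_sum, Algebra.smul_def] at this
    simp only [AddSubmonoidClass.coe_finsetSum, MulMemClass.coe_mul, SubmonoidClass.coe_pow,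
      coe_integersMap, ha', map_mul, ZeroMemClass.coe_zero, mul_assoc]
    exact this
  have hle := addVal_sum_map_mul_pow_le h hϖ a i
  rw [hsum, addVal_zero, top_le_iff] at hle
  have hai : a i = 0 := by
    by_contra h0
    obtain ⟨m, hm⟩ := ENat.ne_top_iff_exists.1 (fun h => h0 (addVal_eq_top_iff.1 h))
    rw [← hm] at hle
    exact ENat.natCast_ne_top (e * m + i) (by exact_mod_cast hle)
  have := ha' i
  rw [hai, ZeroMemClass.coe_zero, eq_comm, mul_eq_zero] at this
  exact this.resolve_left hb0

theorem le_finrank_of_map_primeIdeal_eq {e : ℕ}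
    (h : (primeIdeal p K).map (integersMap p K L) = primeIdeal p L ^ e) :
    e ≤ Module.finrank K L := by
  have := Module.Finite.of_restrictScalars_finite ℚ_[p] K L
  obtain ⟨ϖ, hϖ⟩ := exists_irreducible (integers p L)
  simpa using (linearIndependent_pow_of_map_primeIdeal_eq h hϖ).fintype_card_le_finrank

/-- Ramification indices multiply and each is at most the degree; equality for the product forces
equality in both steps. -/
theorem IsTotallyRamified.tower [IsScalarTower K M L] (h : IsTotallyRamified p K L) :
    IsTotallyRamified p K M ∧ IsTotallyRamified p M L := by
  have := Module.Finite.of_restrictScalars_finite ℚ_[p] K L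
  have := Module.Finite.of_restrictScalars_finite ℚ_[p] K M
  have := Module.Finite.of_restrictScalars_finite ℚ_[p] M L
  obtain ⟨e, he⟩ := exists_map_primeIdeal_eq_pow (p := p) (K := K) (L := M)
  obtain ⟨f, hf⟩ := exists_map_primeIdeal_eq_pow (p := p) (K := M) (L := L)
  have h1 := le_finrank_of_map_primeIdeal_eq he
  have h2 := le_finrank_of_map_primeIdeal_eq hf
  have h3 : e * f = Module.finrank K M * Module.finrank M L := by
    rw [Module.finrank_mul_finrank]
    refine maximalIdeal_pow_injective (C := integers p L) ?_
    rw [← h, ← integersMap_comp p K M L, ← Ideal.map_map, he, Ideal.map_pow, hf, ← pow_mul,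
      mul_comm]
  have h4 : 0 < Module.finrank K M := Module.finrank_pos
  have h5 : 0 < Module.finrank M L := Module.finrank_pos
  have h6 : e = Module.finrank K M := by nlinarith
  have h7 : f = Module.finrank M L := by nlinarith
  exact ⟨by rw [IsTotallyRamified, he, h6], by rw [IsTotallyRamified, hf, h7]⟩

/-- Powers of ϖ form a K-basis. With common denominator b and numerators aⱼ, absence of cancellation
gives n·v(b) ≤ n·v(aⱼ) + j, where n is the degree; as j < n, b divides each aⱼ. -/
theorem IsTotallyRamified.isIntegralGenerator (h : IsTotallyRamified p K L)
    {ϖ : integers p L} (hϖ : Irreducible ϖ) : IsIntegralGenerator p K L ϖ := by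
  have := Module.Finite.of_restrictScalars_finite ℚ_[p] K L
  have h0 : 0 < Module.finrank K L := Module.finrank_pos
  have : Nonempty (Fin (Module.finrank K L)) := ⟨⟨0, h0⟩⟩
  intro y
  set B := basisOfLinearIndependentOfCardEqFinrank
    (linearIndependent_pow_of_map_primeIdeal_eq h hϖ) (Fintype.card_fin _) with hB
  set g : Fin (Module.finrank K L) → K := fun j => B.repr (y : L) j
  have hg : ∑ j, g j • (ϖ : L) ^ (j : ℕ) = y := by
    have := B.sum_repr (y : L)
    simpa only [hB, coe_basisOfLinearIndependentOfCardEqFinrank] using this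
  obtain ⟨b, hb⟩ := IsLocalization.exist_integer_multiples_of_finite
    (nonZeroDivisors (integers p K)) g
  choose a ha using hb
  have ha' : ∀ j, ((a j : integers p K) : K) = (b : integers p K) * g j := ha
  have hb0 : (b : integers p K) ≠ 0 := nonZeroDivisors.ne_zero b.2
  have hφb0 : integersMap p K L b ≠ 0 := by
    rwa [Ne, map_eq_zero_iff _ (integersMap_injective p K L)]
  have hsum : ∑ j, integersMap p K L (a j) * ϖ ^ (j : ℕ) = integersMap p K L b * y := by
    apply Subtype.ext
    simp only [AddSubmonoidClass.coe_finsetSum, MulMemClass.coe_mul, SubmonoidClass.coe_pow,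
      coe_integersMap, ha', map_mul, mul_assoc, ← hg, Finset.mul_sum, Algebra.smul_def]
  have hdvd : ∀ j, (b : integers p K) ∣ a j := by
    intro j
    rw [← addVal_le_iff_dvd]
    have hle := addVal_sum_map_mul_pow_le h hϖ a j
    rw [hsum, addVal_mul, addVal_map h h0.ne'] at hle
    obtain ⟨m, hm⟩ := ENat.ne_top_iff_exists.1 (fun h => hb0 (addVal_eq_top_iff.1 h))
    by_cases hj : addVal (integers p K) (a j) = ⊤
    · rw [hj]; exact le_top
    obtain ⟨l, hl⟩ := ENat.ne_top_iff_exists.1 hj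
    rw [← hm, ← hl] at hle ⊢
    have h1 : Module.finrank K L * m ≤ Module.finrank K L * l + j := by
      exact_mod_cast le_self_add.trans hle
    have h2 := j.2
    rw [Nat.cast_le]
    by_contra! hlt
    nlinarith
  choose c hc using hdvd
  refine ⟨∑ j, Polynomial.C (c j) * Polynomial.X ^ (j : ℕ), ?_⟩
  apply mul_left_cancel₀ hφb0
  rw [← hsum, Polynomial.eval₂_finsetSum, Finset.mul_sum]
  refine Finset.sum_congr rfl fun j _ => ?_
  rw [hc, Polynomial.eval₂_mul, Polynomial.eval₂_C, Polynomial.eval₂_X_pow, map_mul, mul_assoc]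

end Extension

/-! ### The divisibility behind the quotient formula -/

section Polynomial

open Polynomial

variable {A R ι : Type*} [CommRing A] [CommRing R]

theorem sub_dvd_map_eval₂_sub (φ : A →+* R) (s : R →+* R) (hs : ∀ a, s (φ a) = φ a) (y : R)
    (g : A[X]) : s y - y ∣ s (g.eval₂ φ y) - g.eval₂ φ y := by
  have h : s (g.eval₂ φ y) = (g.map φ).eval (s y) := by
    rw [eval_map, hom_eval₂]
    congr 1
    exact RingHom.ext hs
  rw [h, ← eval_map]
  exact sub_dvd_eval_sub _ _ _

/-- If `x` generates a ring over `A` and `y` generates the subring of elements fixed by the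
automorphisms `h i`, then `s y - y` is the product of the `s (h i x) - x` up to a unit. -/
theorem associated_prod_map_sub [IsDomain R] [Fintype ι]
    (φ : A →+* R) (h : ι → R →+* R) (s : R →+* R) {x y : R}
    (hs : ∀ a, s (φ a) = φ a) (hh : ∀ i a, h i (φ a) = φ a) (hy : ∀ i, h i y = y)
    (hinj : Function.Injective fun i => h i x) (hx : ∃ i, h i x = x)
    (hyx : ∃ g : A[X], y = g.eval₂ φ x)
    (hcoeff : ∀ n, ∃ g : A[X], (∏ i, (X - C (h i x))).coeff n = g.eval₂ φ y) :
    Associated (∏ i, (s (h i x) - x)) (s y - y) := by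
  have hsf : (∏ i, (X - C (h i x))).map s = ∏ i, (X - C (s (h i x))) := by
    simp [Polynomial.map_prod]
  have hassoc : Associated (∏ i, (s (h i x) - x)) (((∏ i, (X - C (h i x))).map s).eval x) := by
    rw [hsf, eval_prod]
    refine Associated.prod _ _ _ fun i _ => ?_
    rw [eval_sub, eval_X, eval_C, ← neg_sub]
    exact (Associated.refl _).neg_left
  refine hassoc.trans (associated_of_dvd_dvd ?_ ?_)
  -- Let f = ∏ (X - hᵢx) and y = g(x). Every hᵢx is a root of g - y, so f divides g - y; applying s
  -- to coefficients and evaluating at x, fˢ(x) divides y - sy.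
  · obtain ⟨g, hg⟩ := hyx
    have hdvd : ∏ i, (X - C (h i x)) ∣ g.map φ - C y := by
      by_cases h0 : g.map φ - C y = 0
      · rw [h0]
        exact dvd_zero _
      have hnodup : ((Finset.univ : Finset ι).val.map fun i => h i x).Nodup :=
        Finset.univ.nodup.map hinj
      have := (Multiset.prod_X_sub_C_dvd_iff_le_roots h0 _).2
        ((Multiset.le_iff_subset hnodup).2 fun z hz => by
          obtain ⟨i, -, rfl⟩ := Multiset.mem_map.1 hz
          rw [mem_roots h0, IsRoot, eval_sub, eval_C, eval_map, sub_eq_zero]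
          have hi := congrArg (h i) hg
          rw [hy, hom_eval₂, show (h i).comp φ = φ from RingHom.ext (hh i)] at hi
          exact hi.symm)
      rwa [Multiset.map_map] at this
    obtain ⟨q, hq⟩ := hdvd
    have := congrArg (fun f => (f.map s).eval x) hq
    simp only [Polynomial.map_sub, Polynomial.map_mul, Polynomial.map_map, map_C, eval_sub,
      eval_mul, eval_C] at this
    rw [show s.comp φ = φ from RingHom.ext hs, eval_map, ← hg] at this
    rw [← neg_sub, dvd_neg, this]
    exact dvd_mul_right _ _
  -- Conversely fˢ(x) = fˢ(x) - f(x), and each coefficient c of f is a polynomial in y, so sy - y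
  -- divides sc - c.
  · have h0 : (∏ i, (X - C (h i x))).eval x = 0 := by
      obtain ⟨i, hi⟩ := hx
      rw [eval_prod]
      exact Finset.prod_eq_zero (Finset.mem_univ i) (by simp [hi])
    rw [← sub_zero (eval x _), ← h0, ← eval_sub, eval_eq_sum]
    refine Finset.dvd_sum fun n _ => dvd_mul_of_dvd_left ?_ _
    obtain ⟨g, hg⟩ := hcoeff n
    rw [coeff_sub, coeff_map, hg]
    exact sub_dvd_map_eval₂_sub φ s hs y g

end Polynomial

/-! ### Reading ramification groups from a generator -/

section Extension

variable {p : ℕ} [Fact p.Prime] {K L : Type*} [Field K] [Field L] [Algebra ℚ_[p] K]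
  [Algebra ℚ_[p] L] [Algebra K L] [IsScalarTower ℚ_[p] K L]

theorem smul_integersMap (σ : L ≃ₐ[K] L) (a : integers p K) :
    σ • integersMap p K L a = integersMap p K L a :=
  Subtype.ext (σ.commutes a)

theorem IsIntegralGenerator.smul_injective [FiniteDimensional ℚ_[p] L] {x : integers p L}
    (hx : IsIntegralGenerator p K L x) :
    Function.Injective fun σ : L ≃ₐ[K] L => σ • x := by
  intro σ τ h
  have key : ∀ y : integers p L, σ • y = τ • y := by
    intro y
    obtain ⟨g, rfl⟩ := hx y
    have : ∀ ρ : L ≃ₐ[K] L, ρ • g.eval₂ (integersMap p K L) x =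
        g.eval₂ (integersMap p K L) (ρ • x) := by
      intro ρ
      have h := Polynomial.hom_eval₂ g (integersMap p K L)
        (MulSemiringAction.toRingHom (L ≃ₐ[K] L) (integers p L) ρ) x
      rw [show (MulSemiringAction.toRingHom (L ≃ₐ[K] L) (integers p L) ρ).comp
        (integersMap p K L) = integersMap p K L from RingHom.ext (smul_integersMap ρ)] at h
      exact h
    rw [this, this]
    exact congrArg (fun z => g.eval₂ (integersMap p K L) z) h
  ext z
  obtain ⟨a, b, hb, rfl⟩ := IsFractionRing.div_surjective (A := integers p L) z
  have ha := congrArg Subtype.val (key a)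
  have hb := congrArg Subtype.val (key b)
  rw [map_div₀, map_div₀]
  exact congrArg₂ (· / ·) ha hb

variable [FiniteDimensional ℚ_[p] L]

theorem IsIntegralGenerator.smul_sub_ne_zero {x : integers p L}
    (hx : IsIntegralGenerator p K L x) {σ : L ≃ₐ[K] L} (hσ : σ ≠ 1) : σ • x - x ≠ 0 := by
  intro h
  refine hσ (hx.smul_injective ?_)
  change σ • x = (1 : L ≃ₐ[K] L) • x
  rw [one_smul]
  exact sub_eq_zero.1 h

theorem IsIntegralGenerator.mem_ramificationGroup_iff {x : integers p L}
    (hx : IsIntegralGenerator p K L x) (σ : L ≃ₐ[K] L) (i : ℤ) :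
    σ ∈ ramificationGroup p K L i ↔ ((i + 1).toNat : ℕ∞) ≤ addVal (integers p L) (σ • x - x) := by
  rw [ramificationGroup]
  change (∀ y, _) ↔ _
  simp only [Submodule.mem_toAddSubgroup, ← mem_maximalIdeal_pow_iff]
  refine ⟨fun h => h x, fun h y => ?_⟩
  obtain ⟨g, rfl⟩ := hx y
  exact Ideal.mem_of_dvd _ (sub_dvd_map_eval₂_sub (integersMap p K L)
    (MulSemiringAction.toRingHom (L ≃ₐ[K] L) (integers p L) σ) (smul_integersMap σ) x g) h

/-- The valuation of `σ x - x`, which for a generator `x` of `𝓞_L` is the least `i` such that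
`σ` is not in the `i`-th ramification group. -/
noncomputable def depth (x : integers p L) (σ : L ≃ₐ[K] L) : ℕ :=
  (addVal (integers p L) (σ • x - x)).toNat

theorem IsIntegralGenerator.natCast_depth {x : integers p L}
    (hx : IsIntegralGenerator p K L x) {σ : L ≃ₐ[K] L} (hσ : σ ≠ 1) :
    (depth x σ : ℕ∞) = addVal (integers p L) (σ • x - x) :=
  ENat.natCast_toNat fun h => hx.smul_sub_ne_zero hσ (addVal_eq_top_iff.1 h)

/-- Every σ ≠ 1 produces a jump at `depth x σ - 1`, the last index whose ramification group contains
σ. -/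
theorem IsUniqueJump.depth_eq {t : ℤ} (ht : IsUniqueJump p K L t) {x : integers p L}
    (hx : IsIntegralGenerator p K L x) {σ : L ≃ₐ[K] L} (hσ : σ ≠ 1) :
    (depth x σ : ℤ) = t + 1 := by
  have hmem : ∀ (τ : L ≃ₐ[K] L), τ ≠ 1 → ∀ i, τ ∈ ramificationGroup p K L i ↔
      i + 1 ≤ depth x τ := by
    intro τ hτ i
    rw [hx.mem_ramificationGroup_iff, ← hx.natCast_depth hτ, Nat.cast_le]
    omega
  by_contra hne
  have hjump : ∀ τ : L ≃ₐ[K] L, τ ≠ 1 → IsJump p K L (depth x τ - 1) := by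
    intro τ hτ h
    have h1 := hmem τ hτ (depth x τ - 1)
    rw [h, hmem τ hτ] at h1
    omega
  have := ht.2 _ (hjump σ hσ)
  omega

end Extension

/-! ### Lower numbering and quotients -/

section Galois

variable {p : ℕ} [Fact p.Prime] {K L : Type*} [Field K] [Field L] [Algebra ℚ_[p] K]
  [Algebra ℚ_[p] L] [Algebra K L] [IsScalarTower ℚ_[p] K L]
  (M : IntermediateField K L) [FiniteDimensional ℚ_[p] L]

theorem exists_integersMap_eq_of_smul_eq [IsGalois M L] {c : integers p L}
    (hc : ∀ σ : L ≃ₐ[M] L, σ • c = c) : ∃ b : integers p M, c = integersMap p M L b := by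
  have := Module.Finite.of_restrictScalars_finite ℚ_[p] M L
  obtain ⟨b, hb⟩ := IntermediateField.mem_bot.1 ((IsGalois.mem_bot_iff_fixed (F := M) (c : L)).2
    fun σ => congrArg Subtype.val (hc σ))
  refine ⟨⟨b, ?_⟩, Subtype.ext hb.symm⟩
  have hint : IsIntegral (PadicInt.subring p) (algebraMap M L b) := by rw [hb]; exact c.2
  exact (isIntegral_algHom_iff ((IsScalarTower.toAlgHom ℚ_[p] M L).restrictScalars
    (PadicInt.subring p)) (algebraMap M L).injective).1 hint

variable {M}

/-- The product of the shx - x, over h in Gal(L/M), is associated to sy - y. Taking v_L, which on M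
is [L : M] times v_M, gives the sum; s is nontrivial on M, so v_M(sy - y) = t + 1. -/
theorem sum_depth_mul [FiniteDimensional ℚ_[p] K] [FiniteDimensional ℚ_[p] M] [IsGalois K M]
    [IsGalois M L] [Fintype (L ≃ₐ[M] L)] {x : integers p L} {y : integers p M}
    (hx : IsIntegralGenerator p K L x) (hy : IsIntegralGenerator p K M y)
    (hram : IsTotallyRamified p M L) {t : ℤ} (ht : IsUniqueJump p K M t)
    {s : L ≃ₐ[K] L} (hs : s ∉ M.fixingSubgroup) :
    ∑ h : L ≃ₐ[M] L, (depth x (s * h.restrictScalars K) : ℤ) = Module.finrank M L * (t + 1) := by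
  have := Module.Finite.of_restrictScalars_finite ℚ_[p] M L
  have hsM : s.restrictNormal M ≠ 1 := by
    intro h
    refine hs ((IntermediateField.mem_fixingSubgroup_iff _ _).2 fun z hz => ?_)
    have := s.restrictNormal_commutes M ⟨z, hz⟩
    rw [h] at this
    exact this.symm
  have hsh : ∀ h : L ≃ₐ[M] L, s * h.restrictScalars K ≠ 1 := by
    intro h h1
    refine hs ((IntermediateField.mem_fixingSubgroup_iff _ _).2 fun z hz => ?_)
    have h2 : (s * h.restrictScalars K) z = z := by rw [h1]; rfl
    have h3 : h z = z := h.commutes ⟨z, hz⟩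
    change s (h z) = z at h2
    rwa [h3] at h2
  have hassoc := associated_prod_map_sub (integersMap p K L)
    (fun h : L ≃ₐ[M] L => MulSemiringAction.toRingHom (L ≃ₐ[M] L) (integers p L) h)
    (MulSemiringAction.toRingHom (L ≃ₐ[K] L) (integers p L) s) (x := x)
    (y := integersMap p M L y) (smul_integersMap s)
    (fun h a => smul_integersMap (h.restrictScalars K) a) (fun h => smul_integersMap h y)
    -- The coefficients of ∏ (X - hx) are fixed by Gal(L/M), so they lie in 𝓞_M = 𝓞_K[y].
    (hx.of_tower (M := M)).smul_injective ⟨1, one_smul _ x⟩ (hx _) (by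
      intro n
      obtain ⟨b, hb⟩ := exists_integersMap_eq_of_smul_eq M
        (c := (∏ h : L ≃ₐ[M] L, (Polynomial.X - Polynomial.C (h • x))).coeff n) (by
          intro σ
          have := Polynomial.coeff_map (p := ∏ h : L ≃ₐ[M] L,
            (Polynomial.X - Polynomial.C (h • x)))
            (MulSemiringAction.toRingHom (L ≃ₐ[M] L) (integers p L) σ) n
          refine this.symm.trans ?_
          congr 1
          rw [Polynomial.map_prod]
          refine Fintype.prod_equiv (Equiv.mulLeft σ) _ _ fun h => ?_
          simp [mul_smul])
      obtain ⟨g, hg⟩ := hy b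
      refine ⟨g, hb.trans ?_⟩
      rw [hg, Polynomial.hom_eval₂, integersMap_comp])
  have hval := (addVal_eq_iff_associated _ _).2 hassoc
  have hsy : s • integersMap p M L y - integersMap p M L y =
      integersMap p M L (s.restrictNormal M • y - y) := by
    rw [map_sub]
    congr 1
    exact Subtype.ext (s.restrictNormal_commutes M y).symm
  change addVal _ _ = addVal _ (s • integersMap p M L y - integersMap p M L y) at hval
  rw [hsy, addVal_map hram Module.finrank_pos.ne', ← hy.natCast_depth hsM, addVal_prod] at hval
  have hnat : ∑ h : L ≃ₐ[M] L, depth x (s * h.restrictScalars K) =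
      Module.finrank M L * depth y (s.restrictNormal M) := by
    rw [← ENat.natCast_inj, Nat.cast_mul, ← hval, Nat.cast_sum]
    refine Finset.sum_congr rfl fun h _ => ?_
    rw [hx.natCast_depth (hsh h), mul_smul]
    rfl
  rw [← ht.depth_eq hy hsM]
  exact_mod_cast hnat

end Galois

theorem addVal_ringEquiv {C : Type*} [CommRing C] [IsDomain C] [IsDiscreteValuationRing C]
    (f : C ≃+* C) (z : C) : addVal C (f z) = addVal C z := by
  obtain ⟨ϖ, hϖ⟩ := exists_irreducible C
  by_cases hz : z = 0
  · simp [hz]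
  obtain ⟨n, u, rfl⟩ := eq_unit_mul_pow_irreducible hz hϖ
  have hf : Irreducible (f ϖ) := (MulEquiv.irreducible_iff f).2 hϖ
  rw [addVal_def' u hϖ]
  exact addVal_def _ (Units.mapEquiv (f : C ≃* C) u) hf n (by simp)

/-- Used for a matrix and its transpose, so that the two evaluations of the total can be compared.
-/
theorem sum_sum_eq_of_rows {ι κ : Type*} [Fintype ι] [Fintype κ] (D : ι → κ → ℤ) (i₀ : ι) (k₀ : κ)
    {a b : ℤ} (ha : ∀ i ≠ i₀, ∑ k, D i k = a) (hb : ∀ k ≠ k₀, D i₀ k = b) :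
    ∑ i, ∑ k, D i k = D i₀ k₀ + (Fintype.card κ - 1) * b + (Fintype.card ι - 1) * a := by
  classical
  rw [← Finset.add_sum_erase _ _ (Finset.mem_univ i₀),
    Finset.sum_congr rfl fun i hi => ha i (Finset.ne_of_mem_erase hi),
    ← Finset.add_sum_erase _ _ (Finset.mem_univ k₀),
    Finset.sum_congr rfl fun k hk => hb k (Finset.ne_of_mem_erase hk)]
  have hι : 1 ≤ Fintype.card ι := Fintype.card_pos_iff.2 ⟨i₀⟩
  have hκ : 1 ≤ Fintype.card κ := Fintype.card_pos_iff.2 ⟨k₀⟩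
  simp [Finset.card_erase_of_mem, Nat.cast_sub hι, Nat.cast_sub hκ]

/-! ### The two commuting subgroups of a compositum -/

section Galois

variable {p : ℕ} [Fact p.Prime] {K L : Type*} [Field K] [Field L] [Algebra ℚ_[p] K]
  [Algebra ℚ_[p] L] [Algebra K L] [IsScalarTower ℚ_[p] K L]

/-- In στx - x = (σx - x) + σ(τx - x), σ preserves valuations, so the first term strictly dominates.
-/
theorem depth_mul_of_lt [FiniteDimensional ℚ_[p] L] {x : integers p L}
    (hx : IsIntegralGenerator p K L x) {σ τ : L ≃ₐ[K] L} (hσ : σ ≠ 1) (hτ : τ ≠ 1)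
    (h : depth x σ < depth x τ) : depth x (σ * τ) = depth x σ := by
  have hlt : addVal (integers p L) (σ • x - x) < addVal (integers p L) (σ • (τ • x - x)) := by
    have hu : addVal (integers p L) (σ • (τ • x - x)) = addVal (integers p L) (τ • x - x) :=
      addVal_ringEquiv (MulSemiringAction.toRingEquiv (L ≃ₐ[K] L) (integers p L) σ) _
    rw [hu, ← hx.natCast_depth hσ, ← hx.natCast_depth hτ]
    exact_mod_cast h
  have hsum : (σ * τ) • x - x = (σ • x - x) + σ • (τ • x - x) := by
    rw [smul_sub, mul_smul]
    ring
  rw [depth, hsum, addVal_add_eq_of_lt hlt, depth]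

variable {K₁ K₂ : IntermediateField K L}

theorem eq_one_of_mem_fixingSubgroup (hsup : K₁ ⊔ K₂ = ⊤) {σ : L ≃ₐ[K] L}
    (h₁ : σ ∈ K₁.fixingSubgroup) (h₂ : σ ∈ K₂.fixingSubgroup) : σ = 1 := by
  have : σ ∈ (K₁ ⊔ K₂).fixingSubgroup := by
    rw [IntermediateField.fixingSubgroup_sup]
    exact ⟨h₁, h₂⟩
  rwa [hsup, IntermediateField.fixingSubgroup_top, Subgroup.mem_bot] at this

theorem restrictScalars_mem_fixingSubgroup (M : IntermediateField K L) (σ : L ≃ₐ[M] L) :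
    σ.restrictScalars K ∈ M.fixingSubgroup :=
  (IntermediateField.mem_fixingSubgroup_iff _ _).2 fun z hz => σ.commutes ⟨z, hz⟩

theorem restrictScalars_notMem_fixingSubgroup (hsup : K₁ ⊔ K₂ = ⊤) {σ : L ≃ₐ[K₂] L} (hσ : σ ≠ 1) :
    σ.restrictScalars K ∉ K₁.fixingSubgroup := fun h => hσ <| AlgEquiv.restrictScalars_injective K
  (eq_one_of_mem_fixingSubgroup hsup h (restrictScalars_mem_fixingSubgroup K₂ σ))

/-- Both fixing subgroups are normal and meet trivially, since K₁ and K₂ generate L. -/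
theorem restrictScalars_commute [IsGalois K K₁] [IsGalois K K₂] (hsup : K₁ ⊔ K₂ = ⊤)
    (σ : L ≃ₐ[K₂] L) (τ : L ≃ₐ[K₁] L) :
    σ.restrictScalars K * τ.restrictScalars K = τ.restrictScalars K * σ.restrictScalars K := by
  have hσ := restrictScalars_mem_fixingSubgroup K₂ σ
  have hτ := restrictScalars_mem_fixingSubgroup K₁ τ
  have : K₁.fixingSubgroup.Normal :=
    K₁.restrictNormalHom_ker ▸ MonoidHom.normal_ker _
  have : K₂.fixingSubgroup.Normal :=
    K₂.restrictNormalHom_ker ▸ MonoidHom.normal_ker _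
  have hdisj : Disjoint K₂.fixingSubgroup K₁.fixingSubgroup := Subgroup.disjoint_def.2
    fun h₂ h₁ => eq_one_of_mem_fixingSubgroup hsup h₁ h₂
  exact Subgroup.commute_of_normal_of_disjoint _ _ ‹_› ‹_› hdisj _ _ hσ hτ

end Galois

end LocalRamification

/-! ### Double counting and the case of degree p -/

theorem mainTheorem12 (p : ℕ) [Fact p.Prime]
    (K L : Type*) [Field K] [Field L] [Algebra ℚ_[p] K] [Algebra ℚ_[p] L]
    [Algebra K L] [IsScalarTower ℚ_[p] K L] [FiniteDimensional ℚ_[p] K]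
    (K₁ K₂ : IntermediateField K L)
    [FiniteDimensional ℚ_[p] K₁] [FiniteDimensional ℚ_[p] K₂] [FiniteDimensional ℚ_[p] L]
    (hinf : K₁ ⊓ K₂ = ⊥) (hsup : K₁ ⊔ K₂ = ⊤)
    [IsGalois K K₁] [IsGalois K K₂]
    (hram : LocalRamification.IsTotallyRamified p K L)
    (t₁ t₂ t₁' t₂' : ℤ)
    (ht₁ : LocalRamification.IsUniqueJump p K K₁ t₁)
    (ht₂ : LocalRamification.IsUniqueJump p K K₂ t₂)
    (ht₁' : LocalRamification.IsUniqueJump p K₂ L t₁')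
    (ht₂' : LocalRamification.IsUniqueJump p K₁ L t₂')
    (d₁ d₂ : ℕ) (hd₁ : d₁ = Module.finrank K K₁) (hd₂ : d₂ = Module.finrank K K₂) :
    (d₂ : ℤ) * (d₁ - 1) * t₁ + (d₂ - 1) * t₂' = d₁ * (d₂ - 1) * t₂ + (d₁ - 1) * t₁' ∧
      (d₁ = p → d₂ = p → t₁' < t₂' → t₁' = t₁ ∧ t₂' = p * t₂ + (1 - p) * t₁) := by
  open LocalRamification in
  have := Module.Finite.of_restrictScalars_finite ℚ_[p] K L
  have hsup' : K₂ ⊔ K₁ = ⊤ := by rwa [sup_comm]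
  have : IsGalois K₂ L := IsGalois.sup_right K₁ K₂ hsup
  have : IsGalois K₁ L := IsGalois.sup_right K₂ K₁ hsup'
  have hdis : K₁.LinearDisjoint K₂ := IntermediateField.LinearDisjoint.of_inf_eq_bot hinf
  have hr₁ : Module.finrank K₁ L = d₂ := hd₂ ▸ hdis.finrank_left_eq_finrank hsup
  have hr₂ : Module.finrank K₂ L = d₁ := hd₁ ▸ hdis.finrank_right_eq_finrank hsup
  have hc₁ : Fintype.card (L ≃ₐ[K₁] L) = d₂ := by
    rw [← hr₁, ← IsGalois.card_aut_eq_finrank, Nat.card_eq_fintype_card]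
  have hc₂ : Fintype.card (L ≃ₐ[K₂] L) = d₁ := by
    rw [← hr₂, ← IsGalois.card_aut_eq_finrank, Nat.card_eq_fintype_card]
  obtain ⟨hram₁, hram₁'⟩ := hram.tower (M := K₁)
  obtain ⟨hram₂, hram₂'⟩ := hram.tower (M := K₂)
  obtain ⟨x, hx⟩ := IsDiscreteValuationRing.exists_irreducible (integers p L)
  obtain ⟨y₁, hy₁⟩ := IsDiscreteValuationRing.exists_irreducible (integers p K₁)
  obtain ⟨y₂, hy₂⟩ := IsDiscreteValuationRing.exists_irreducible (integers p K₂)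
  have hgen := hram.isIntegralGenerator hx
  set D : (L ≃ₐ[K₂] L) → (L ≃ₐ[K₁] L) → ℤ := fun σ τ =>
    depth x (σ.restrictScalars K * τ.restrictScalars K) with hD
  have hrow : ∀ σ ≠ 1, ∑ τ, D σ τ = d₂ * (t₁ + 1) := fun σ hσ => hr₁ ▸
    sum_depth_mul hgen (hram₁.isIntegralGenerator hy₁) hram₁' ht₁
      (restrictScalars_notMem_fixingSubgroup hsup hσ)
  have hcol : ∀ τ ≠ 1, ∑ σ, D σ τ = d₁ * (t₂ + 1) := by
    intro τ hτ
    -- The quotient formula needs the fixed factor τ on the left.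
    simp only [hD, restrictScalars_commute hsup]
    exact hr₂ ▸ sum_depth_mul hgen (hram₂.isIntegralGenerator hy₂) hram₂' ht₂
      (restrictScalars_notMem_fixingSubgroup hsup' hτ)
  have hrow1 : ∀ τ ≠ 1, D 1 τ = t₂' + 1 := fun τ hτ => ht₂'.depth_eq hgen.of_tower hτ
  have hcol1 : ∀ σ ≠ 1, D σ 1 = t₁' + 1 := fun σ hσ => ht₁'.depth_eq hgen.of_tower hσ
  have h₁ := sum_sum_eq_of_rows D 1 1 hrow hrow1
  have h₂ := sum_sum_eq_of_rows (fun τ σ => D σ τ) 1 1 hcol hcol1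
  rw [Finset.sum_comm, h₁, hc₁, hc₂] at h₂
  -- The corner D(1, 1), whose valuation ⊤ is truncated to 0, cancels. So do the contributions of
  -- the shifts t + 1, since (d₂ - 1) + (d₁ - 1)d₂ = (d₁ - 1) + (d₂ - 1)d₁.
  have hmain : (d₂ : ℤ) * (d₁ - 1) * t₁ + (d₂ - 1) * t₂' =
      d₁ * (d₂ - 1) * t₂ + (d₁ - 1) * t₁' := by linear_combination h₂
  refine ⟨hmain, fun hp₁ hp₂ hlt => ?_⟩
  have hp : (2 : ℤ) ≤ p := by exact_mod_cast (Fact.out : p.Prime).two_le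
  have hne : ∃ σ : L ≃ₐ[K₂] L, σ ≠ 1 := by
    have : Nontrivial (L ≃ₐ[K₂] L) := by
      rw [← Fintype.one_lt_card_iff_nontrivial, hc₂, hp₁]
      exact (Fact.out : p.Prime).one_lt
    exact exists_ne 1
  obtain ⟨σ, hσ⟩ := hne
  have hconst : ∀ τ, D σ τ = t₁' + 1 := by
    intro τ
    by_cases hτ : τ = 1
    · rw [hτ, hcol1 σ hσ]
    have e₁ : (depth x (σ.restrictScalars K) : ℤ) = t₁' + 1 := ht₁'.depth_eq hgen.of_tower hσ
    have e₂ : (depth x (τ.restrictScalars K) : ℤ) = t₂' + 1 := ht₂'.depth_eq hgen.of_tower hτ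
    rw [← e₁, hD]
    refine congrArg _ (depth_mul_of_lt hgen ?_ ?_ (by omega))
    · exact fun h => hσ (AlgEquiv.restrictScalars_injective K h)
    · exact fun h => hτ (AlgEquiv.restrictScalars_injective K h)
  -- The constant row has p entries, so p(t₁' + 1) = p(t₁ + 1).
  have hs := hrow σ hσ
  simp only [hconst, Finset.sum_const, Finset.card_univ, hc₁, hp₂, nsmul_eq_mul] at hs
  have ht : t₁' = t₁ := by
    have := mul_left_cancel₀ (by omega : (p : ℤ) ≠ 0) hs
    omega
  refine ⟨ht, ?_⟩
  rw [hp₁, hp₂, ht] at hmain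
  -- With d₁ = d₂ = p and t₁' = t₁, every term of (i) has the factor p - 1.
  refine mul_left_cancel₀ (by omega : (p : ℤ) - 1 ≠ 0) ?_
  linear_combination hmain
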